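/- Let $\mathbb{N}$ be the set of positive integers, $\phi$ Euler's totient function, and $V=\phi(\mathbb{N})$ the set of totients. For $m\in V$ put $N_1(m)=\max\{x\in\mathbb{N}:\phi(x)\le m\}$, $N_2(m)=\max\phi^{-1}(m)$ and $N_3(m)=\min\phi^{-1}(m)$, where $\phi^{-1}(m)=\{x\in\mathbb{N}:\phi(x)=m\}$, and put $N_i=\{N_i(m):m\in V\}$ for $i=1,2,3$; the elements of $N_1$ are the sparsely totient numbers. A Følner sequence in $\mathbb{N}$ is a sequence $(F_n)_{n\in\mathbb{N}}$ of finite subsets of $\mathbb{N}$ such that $\lim_{n\to\infty}|(g+F_n)\cap F_n|/|F_n|=1$ for every $g\in\mathbb{N}$. The Banach density of $A\subseteq\mathbb{N}$ is $$d^*(A)=\sup\Big\{\limsup_{n\to\infty}\frac{|F_n\cap A|}{|F_n|} : (F_n)_{n\in\mathbb{N}}\text{ is a Følner sequence in }\mathbb{N}\Big\},$$ and $A$ has asymptotic density $d$ if $\lim_{n\to\infty}|A\cap\{1,\dots,n\}|/n=d$. Theorem. (i) The Banach density of $N_1$ is zero. (ii) If $f\colon V\to\mathbb{N}$ is a function such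 that $f(m)\in\phi^{-1}(m)$ for every $m\in V$, then $f(V)$ has asymptotic density $0$. In particular, $N_2$ and $N_3$ have asymptotic density $0$. -/

import Mathlib

open Filter Topology

/-- Euler's function as a map from the positive integers to the positive integers. -/
def eulerPhi (x : ℕ+) : ℕ+ := ⟨Nat.totient x, Nat.totient_pos.2 x.pos⟩

/-- The set `V` of totients, the image of Euler's function. -/
def totients : Set ℕ+ := Set.range eulerPhi

theorem le_of_totient_le {n m : ℕ} (hn : 0 < n) (h : Nat.totient n ≤ m) :
    n ≤ (m * (m + 1)) ^ (m + 2) := by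
  have hpos : 0 < Nat.totient n := Nat.totient_pos.2 hn
  have hm : 0 < m := hpos.trans_le h
  have key : ∀ p ∈ n.primeFactors, p ≤ m + 1 ∧ p ^ n.factorization p ≤ m * (m + 1) := by
    intro p hp
    have hpp := Nat.prime_of_mem_primeFactors hp
    have hdvd : p ^ n.factorization p ∣ n := Nat.ordProj_dvd n p
    have hk : 0 < n.factorization p :=
      hpp.factorization_pos_of_dvd hn.ne' (Nat.dvd_of_mem_primeFactors hp)
    have h1 : Nat.totient (p ^ n.factorization p) ≤ m :=
      (Nat.le_of_dvd hpos (Nat.totient_dvd_of_dvd hdvd)).trans h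
    rw [Nat.totient_prime_pow hpp hk] at h1
    have hp2 : 1 ≤ p - 1 := by have := hpp.two_le; omega
    have ha : 1 ≤ p ^ (n.factorization p - 1) := Nat.pow_pos hpp.pos
    have h2 : p ^ (n.factorization p - 1) ≤ m := by nlinarith
    have h3 : p - 1 ≤ m := by nlinarith
    have h4 : p ≤ m + 1 := by omega
    refine ⟨h4, ?_⟩
    calc p ^ n.factorization p = p ^ (n.factorization p - 1) * p := by
          rw [← pow_succ]; congr 1; omega
      _ ≤ m * (m + 1) := Nat.mul_le_mul h2 h4
  calc n = ∏ p ∈ n.primeFactors, p ^ n.factorization p :=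
        (Nat.prod_factorization_pow_eq_self hn.ne').symm
    _ ≤ (m * (m + 1)) ^ n.primeFactors.card :=
        Finset.prod_le_pow_card _ _ _ fun p hp => (key p hp).2
    _ ≤ (m * (m + 1)) ^ (m + 2) := by
        apply Nat.pow_le_pow_right (by positivity)
        have : n.primeFactors ⊆ Finset.range (m + 2) := fun p hp => by
          have := (key p hp).1
          simp only [Finset.mem_range]; omega
        simpa using Finset.card_le_card this

theorem finite_eulerPhi_le (m : ℕ+) : {x : ℕ+ | eulerPhi x ≤ m}.Finite := by
  apply (Set.finite_Iic ((m * (m + 1)) ^ ((m : ℕ) + 2))).subset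
  intro x hx
  have h := le_of_totient_le (n := x) (m := m) x.pos hx
  rw [Set.mem_Iic, ← PNat.coe_le_coe]
  push_cast
  exact h

theorem exists_isGreatest_eulerPhi_le (m : totients) :
    ∃ x, IsGreatest {x : ℕ+ | eulerPhi x ≤ m} x := by
  obtain ⟨y, hy⟩ := m.2
  obtain ⟨x, hx, h⟩ := Set.exists_max_image _ id (finite_eulerPhi_le m) ⟨y, hy.le⟩
  exact ⟨x, hx, h⟩

theorem exists_isGreatest_fiber (m : totients) :
    ∃ x, IsGreatest {x : ℕ+ | eulerPhi x = m} x := by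
  obtain ⟨y, hy⟩ := m.2
  obtain ⟨x, hx, h⟩ := Set.exists_max_image {x : ℕ+ | eulerPhi x = m} id
    ((finite_eulerPhi_le m).subset fun _ h => le_of_eq h) ⟨y, hy⟩
  exact ⟨x, hx, h⟩

theorem exists_isLeast_fiber (m : totients) :
    ∃ x, IsLeast {x : ℕ+ | eulerPhi x = m} x := by
  obtain ⟨y, hy⟩ := m.2
  obtain ⟨x, hx, h⟩ := Set.exists_min_image {x : ℕ+ | eulerPhi x = m} id
    ((finite_eulerPhi_le m).subset fun _ h => le_of_eq h) ⟨y, hy⟩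
  exact ⟨x, hx, h⟩

/-- `N₁(m) = max {x : φ(x) ≤ m}` for a totient `m`. -/
noncomputable def N₁ (m : totients) : ℕ+ := (exists_isGreatest_eulerPhi_le m).choose

/-- `N₂(m) = max φ⁻¹(m)` for a totient `m`. -/
noncomputable def N₂ (m : totients) : ℕ+ := (exists_isGreatest_fiber m).choose

/-- `N₃(m) = min φ⁻¹(m)` for a totient `m`. -/
noncomputable def N₃ (m : totients) : ℕ+ := (exists_isLeast_fiber m).choose

/-- A Følner sequence in the semigroup `(ℕ+, +)`: a sequence of finite sets with
`|(g + F n) ∩ F n| / |F n| → 1` for every `g`. -/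
def IsFolner (F : ℕ+ → Finset ℕ+) : Prop :=
  ∀ g : ℕ+, Tendsto
    (fun n => (((F n).image (fun x => g + x) ∩ F n).card : ℝ) / ((F n).card : ℝ)) atTop (𝓝 1)

open Classical in
/-- The proportion `|F ∩ A| / |F|`; it always lies in `[0, 1]`. -/
noncomputable def proportion (F : Finset ℕ+) (A : Set ℕ+) : ℝ :=
  ((F.filter (fun x => x ∈ A)).card : ℝ) / (F.card : ℝ)

/-- The upper density of `A` with respect to the sequence `F`. -/
noncomputable def upperDensity (F : ℕ+ → Finset ℕ+) (A : Set ℕ+) : ℝ :=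
  limsup (fun n => proportion (F n) A) atTop

/-- The Banach density of `A`: the supremum of its upper densities with respect to all
Følner sequences. -/
noncomputable def banachDensity (A : Set ℕ+) : ℝ :=
  sSup {d : ℝ | ∃ F : ℕ+ → Finset ℕ+, IsFolner F ∧ d = upperDensity F A}

/-- The set `A` has density `d` with respect to the sequence `F`. -/
def HasDensity (F : ℕ+ → Finset ℕ+) (A : Set ℕ+) (d : ℝ) : Prop :=
  Tendsto (fun n => proportion (F n) A) atTop (𝓝 d)

/-- The set `A` has asymptotic density `d`: its density along the intervals `[1, n]`. -/
def HasAsymptoticDensity (A : Set ℕ+) (d : ℝ) : Prop :=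
  HasDensity (fun n => Finset.Icc 1 n) A d

/-! Both parts rest on elementary multiplicative properties of the totient.

*Sparsely totient numbers.* An element `n` of `N₁` satisfies `φ n < φ x` for all `x > n`. Let `p` be
a prime not dividing such an `n`, and let `d ≥ p²` be either a prime divisor of `n` or a prime power
`q ^ a` with `q ^ (a + 1) ∣ n`. Replacing the factor `d` of `n` by the next multiple of `p`,
namely `p * (d / p + 1)`, yields a larger number whose totient is not larger. Hence no such `d`
exists, which bounds `n` in terms of `p`: all but finitely many elements of `N₁` are multiples of
`p` (`dvd_of_forall_totient_lt`). A set having `k` pairwise disjoint translates occupies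
asymptotically at most the proportion `1 / k` of any Følner sequence
(`IsFolner.eventually_proportion_le`). This applies to the multiples of `p` (with `k = p`) and to a
finite set (with any `k`), and `p` is arbitrary.

*Sections of the totient.* On `f(V)` the map `φ` is injective. The elements of `f(V)` up to `n`
with at least `k` odd prime factors are sent by `φ` to multiples of `2 ^ k` in `[1, n]`, so there
are at most `n / 2 ^ k` of them. The integers with fewer than `k` odd prime factors have density
zero (`eventually_card_few_primeFactors_le`), since `∑ 1 / p` diverges and therefore all integers up to a
small proportion have a prime factor in a suitable finite set of primes beyond any given bound. -/

/-! ### Divisibility of sparsely totient numbers -/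

theorem totient_mul_le_mul_totient (a b : ℕ) : Nat.totient (a * b) ≤ a * Nat.totient b := by
  induction a using Nat.recOnMul generalizing b with
  | zero => simp
  | one => simp
  | prime p hp =>
    by_cases h : p ∣ b
    · rw [Nat.totient_mul_of_prime_of_dvd hp h]
    · rw [Nat.totient_mul_of_prime_of_not_dvd hp h]
      exact Nat.mul_le_mul_right _ (Nat.sub_le _ _)
  | mul x y hx hy =>
    rw [mul_assoc, mul_assoc]
    exact (hx _).trans (Nat.mul_le_mul_left x (hy b))

theorem totient_prime_pow_mul_of_dvd {q e : ℕ} (hq : q.Prime) (h : q ∣ e) (a : ℕ) :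
    Nat.totient (q ^ a * e) = q ^ a * Nat.totient e := by
  induction a with
  | zero => simp
  | succ a ih =>
    rw [pow_succ', mul_assoc, Nat.totient_mul_of_prime_of_dvd hq (h.mul_left _), ih, mul_assoc]

/-- Replacing a divisor `d ≥ p²` of `n = d * e` by the next multiple of `p` increases the number,
but multiplies `φ e` by at most `(p - 1) * (d / p + 1) ≤ d - 1`. -/
theorem exists_gt_totient_le {p d e : ℕ} (hp : p.Prime) (he : 0 < e) (hpe : ¬ p ∣ e)
    (hd : p ^ 2 ≤ d) :
    ∃ x, d * e < x ∧ Nat.totient x ≤ (d - 1) * Nat.totient e := by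
  refine ⟨(d / p + 1) * (p * e), ?_, ?_⟩
  · rw [← mul_assoc]
    refine Nat.mul_lt_mul_of_pos_right ?_ he
    have := Nat.div_add_mod d p
    have := Nat.mod_lt d hp.pos
    nlinarith
  · refine (totient_mul_le_mul_totient _ _).trans ?_
    rw [Nat.totient_mul_of_prime_of_not_dvd hp hpe, ← mul_assoc]
    refine Nat.mul_le_mul_right _ ?_
    have h1 : p * (d / p) ≤ d := Nat.mul_div_le d p
    have h2 : p ≤ d / p := by
      rw [Nat.le_div_iff_mul_le hp.pos]
      nlinarith
    obtain ⟨r, rfl⟩ : ∃ r, p = r + 1 := ⟨p - 1, by have := hp.pos; omega⟩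
    apply Nat.le_sub_of_add_le
    simp only [Nat.add_sub_cancel]
    nlinarith

/-- Every prime `p` divides all sufficiently large sparsely totient numbers. -/
theorem dvd_of_forall_totient_lt {p n : ℕ} (hp : p.Prime) (hn : 0 < n)
    (h : ∀ x, n < x → Nat.totient n < Nat.totient x) (hlarge : (p ^ 4) ^ (p ^ 2) < n) :
    p ∣ n := by
  by_contra hpn
  have key : ∀ q ∈ n.primeFactors, q < p ^ 2 ∧ q ^ n.factorization q ≤ p ^ 4 := by
    intro q hq
    have hqp := Nat.prime_of_mem_primeFactors hq
    have hqn := Nat.dvd_of_mem_primeFactors hq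
    have hq2 : q < p ^ 2 := by
      by_contra! hle
      obtain ⟨e, rfl⟩ := hqn
      obtain ⟨x, hx, hx'⟩ := exists_gt_totient_le hp (Nat.pos_of_mul_pos_left hn)
        (fun hh => hpn (hh.mul_left _)) hle
      have h1 := Nat.totient_super_multiplicative q e
      rw [Nat.totient_prime hqp] at h1
      exact absurd (h x hx) (by omega)
    refine ⟨hq2, ?_⟩
    by_contra! hlt
    have hv : 0 < n.factorization q := hqp.factorization_pos_of_dvd hn.ne' hqn
    obtain ⟨a, ha⟩ : ∃ a, n.factorization q = a + 1 := ⟨n.factorization q - 1, by omega⟩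
    have hdvd : q ^ (a + 1) ∣ n := ha ▸ Nat.ordProj_dvd n q
    rw [ha, pow_succ] at hlt
    have hd : p ^ 2 ≤ q ^ a := by
      by_contra! hlt'
      have := Nat.mul_le_mul hlt'.le hq2.le
      rw [← pow_add] at this
      exact absurd hlt (not_lt.2 this)
    obtain ⟨c, rfl⟩ := hdvd
    rw [pow_succ, mul_assoc] at h hn hpn
    obtain ⟨x, hx, hx'⟩ := exists_gt_totient_le hp (Nat.pos_of_mul_pos_left hn)
      (fun hh => hpn (hh.mul_left _)) hd
    have h1 := h x hx
    rw [totient_prime_pow_mul_of_dvd hqp (Dvd.intro _ rfl)] at h1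
    exact absurd (h1.trans_le hx') (not_lt.2 (Nat.mul_le_mul_right _ (Nat.sub_le _ _)))
  refine absurd hlarge (not_lt.2 ?_)
  calc n = ∏ q ∈ n.primeFactors, q ^ n.factorization q :=
        (Nat.prod_factorization_pow_eq_self hn.ne').symm
    _ ≤ (p ^ 4) ^ n.primeFactors.card :=
        Finset.prod_le_pow_card _ _ _ fun q hq => (key q hq).2
    _ ≤ (p ^ 4) ^ (p ^ 2) := by
        apply Nat.pow_le_pow_right (pow_pos hp.pos _)
        have : n.primeFactors ⊆ Finset.range (p ^ 2) := fun q hq =>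
          Finset.mem_range.2 (key q hq).1
        simpa using Finset.card_le_card this

theorem totient_lt_of_N₁_lt (m : totients) (x : ℕ) (hx : (N₁ m : ℕ) < x) :
    Nat.totient (N₁ m) < Nat.totient x := by
  have hg := (exists_isGreatest_eulerPhi_le m).choose_spec
  have h1 : eulerPhi (N₁ m) ≤ m := hg.1
  have hx0 : 0 < x := (Nat.zero_le _).trans_lt hx
  by_contra! hle
  have h2 : (⟨x, hx0⟩ : ℕ+) ≤ N₁ m := hg.2 (le_trans (b := eulerPhi (N₁ m)) hle h1)
  exact absurd hx (not_lt.2 h2)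

theorem dvd_of_mem_range_N₁ {p : ℕ} (hp : p.Prime) {n : ℕ+} (hn : n ∈ Set.range N₁)
    (hlarge : (p ^ 4) ^ (p ^ 2) < (n : ℕ)) : p ∣ n := by
  obtain ⟨m, rfl⟩ := hn
  exact dvd_of_forall_totient_lt hp (N₁ m).pos (totient_lt_of_N₁_lt m) hlarge

/-! ### Proportions along Følner sequences -/

theorem proportion_nonneg (F : Finset ℕ+) (A : Set ℕ+) : 0 ≤ proportion F A := by
  unfold proportion
  positivity

theorem proportion_union_le (F : Finset ℕ+) (A B : Set ℕ+) :
    proportion F (A ∪ B) ≤ proportion F A + proportion F B := by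
  classical
  unfold proportion
  rw [← add_div]
  gcongr
  norm_cast
  simp only [Set.mem_union, Finset.filter_or]
  exact Finset.card_union_le _ _

theorem proportion_mono (F : Finset ℕ+) {A B : Set ℕ+} (h : A ⊆ B) :
    proportion F A ≤ proportion F B := by
  classical
  unfold proportion
  gcongr

theorem hasDensity_zero_of_eventually_le {F : ℕ+ → Finset ℕ+} {A : Set ℕ+}
    (h : ∀ ε : ℝ, 0 < ε → ∀ᶠ n in atTop, proportion (F n) A ≤ ε) : HasDensity F A 0 := by
  refine tendsto_order.2 ⟨fun a ha => .of_forall fun n => ha.trans_le (proportion_nonneg _ _),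
    fun a ha => ?_⟩
  filter_upwards [h (a / 2) (half_pos ha)] with n hn
  linarith

/-- If `A` has `k` pairwise disjoint translates, then it occupies asymptotically at most the
proportion `1 / k` of a Følner sequence. -/
theorem IsFolner.eventually_proportion_le {F : ℕ+ → Finset ℕ+} (hF : IsFolner F) {A : Set ℕ+}
    {k : ℕ} (hk : 0 < k) (g : ℕ → ℕ+)
    (hg : ∀ i < k, ∀ j < k, i ≠ j → ∀ x ∈ A, ∀ y ∈ A, g i + x ≠ g j + y) {ε : ℝ} (hε : 0 < ε) :
    ∀ᶠ n in atTop, proportion (F n) A ≤ 1 / k + ε := by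
  classical
  have hev : ∀ᶠ n in atTop, ∀ i ∈ Finset.range k, 1 - ε <
      (((F n).image (fun x => g i + x) ∩ F n).card : ℝ) / ((F n).card : ℝ) :=
    (Finset.eventually_all _).2 fun i _ => (hF (g i)).eventually_const_lt (by linarith)
  filter_upwards [hev] with n hn
  unfold proportion
  rcases Nat.eq_zero_or_pos (F n).card with h0 | hpos
  · rw [h0]
    simp only [Nat.cast_zero, div_zero]
    positivity
  have hc : (0 : ℝ) < (F n).card := by exact_mod_cast hpos
  have hk' : (0 : ℝ) < k := by exact_mod_cast hk
  set G := (F n).filter (fun x => x ∈ A) with hG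
  let T : ℕ → Finset ℕ+ := fun i => G.image (fun x => g i + x) ∩ F n
  have hT : ∀ i ∈ Finset.range k, (G.card : ℝ) - ε * (F n).card ≤ (T i).card := by
    intro i hi
    have h1 := hn i hi
    rw [lt_div_iff₀ hc] at h1
    have hsub : (F n).image (fun x => g i + x) ∩ F n ⊆
        T i ∪ (F n \ G).image (fun x => g i + x) := by
      intro y hy
      simp only [Finset.mem_inter, Finset.mem_image] at hy
      obtain ⟨⟨x, hx, rfl⟩, hy⟩ := hy
      by_cases hxG : x ∈ G
      · exact Finset.mem_union_left _
          (Finset.mem_inter.2 ⟨Finset.mem_image_of_mem _ hxG, hy⟩)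
      · exact Finset.mem_union_right _
          (Finset.mem_image_of_mem _ (Finset.mem_sdiff.2 ⟨hx, hxG⟩))
    have h2 := ((Finset.card_le_card hsub).trans (Finset.card_union_le _ _)).trans
      (Nat.add_le_add_left Finset.card_image_le _)
    have h3 := Finset.card_sdiff_add_card_eq_card (Finset.filter_subset (fun x => x ∈ A) (F n))
    rw [← hG] at h3
    have h2' : (((F n).image (fun x => g i + x) ∩ F n).card : ℝ) ≤
      (T i).card + (F n \ G).card := by exact_mod_cast h2
    have h3' : ((F n \ G).card : ℝ) + G.card = (F n).card := by exact_mod_cast h3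
    linarith
  have hdisj : ∑ i ∈ Finset.range k, (T i).card ≤ (F n).card := by
    rw [← Finset.card_biUnion]
    · exact Finset.card_le_card (Finset.biUnion_subset.2 fun i _ => Finset.inter_subset_right)
    · intro i hi j hj hij
      refine Finset.disjoint_left.2 fun z hz hz' => ?_
      obtain ⟨x, hx, rfl⟩ := Finset.mem_image.1 (Finset.mem_inter.1 hz).1
      obtain ⟨y, hy, hxy⟩ := Finset.mem_image.1 (Finset.mem_inter.1 hz').1
      exact hg i (Finset.mem_range.1 hi) j (Finset.mem_range.1 hj) hij x
        (Finset.mem_filter.1 hx).2 y (Finset.mem_filter.1 hy).2 hxy.symm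
  have hsum : (k : ℝ) * (G.card - ε * (F n).card) ≤ (F n).card := by
    have h1 := Finset.card_nsmul_le_sum _ _ _ hT
    rw [Finset.card_range, nsmul_eq_mul] at h1
    exact h1.trans (by exact_mod_cast hdisj)
  rw [div_le_iff₀ hc]
  have : (G.card : ℝ) - ε * (F n).card ≤ (F n).card / k := by
    rw [le_div_iff₀ hk']
    linarith
  calc (G.card : ℝ) ≤ (F n).card / k + ε * (F n).card := by linarith
    _ = (1 / k + ε) * (F n).card := by ring

theorem IsFolner.eventually_proportion_multiples_le {F : ℕ+ → Finset ℕ+} (hF : IsFolner F)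
    {k : ℕ} (hk : 0 < k) {ε : ℝ} (hε : 0 < ε) :
    ∀ᶠ n in atTop, proportion (F n) {x : ℕ+ | k ∣ x} ≤ 1 / k + ε := by
  refine hF.eventually_proportion_le hk Nat.succPNat ?_ hε
  intro i hi j hj hij x hx y hy hxy
  have h : i + 1 + (x : ℕ) = j + 1 + y := by
    simpa using congrArg (fun z : ℕ+ => (z : ℕ)) hxy
  obtain ⟨a, ha⟩ := hx
  obtain ⟨b, hb⟩ := hy
  rw [ha, hb] at h
  have h' : i + k * a = j + k * b := by omega
  have := congrArg (· % k) h'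
  simp only [Nat.add_mul_mod_self_left, Nat.mod_eq_of_lt hi, Nat.mod_eq_of_lt hj] at this
  exact hij this

theorem IsFolner.eventually_proportion_bounded_le {F : ℕ+ → Finset ℕ+} (hF : IsFolner F)
    (B : ℕ) {k : ℕ} (hk : 0 < k) {ε : ℝ} (hε : 0 < ε) :
    ∀ᶠ n in atTop, proportion (F n) {x : ℕ+ | (x : ℕ) ≤ B} ≤ 1 / k + ε := by
  refine hF.eventually_proportion_le hk (fun i => Nat.succPNat (i * B)) ?_ hε
  intro i hi j hj hij x hx y hy hxy
  have h : i * B + 1 + (x : ℕ) = j * B + 1 + y := by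
    simpa using congrArg (fun z : ℕ+ => (z : ℕ)) hxy
  have hx0 := x.pos
  have hy0 := y.pos
  simp only [Set.mem_ofPred_eq] at hx hy
  rcases lt_or_gt_of_ne hij with hlt | hlt
  · have := Nat.mul_le_mul_right B (Nat.succ_le_of_lt hlt)
    rw [Nat.succ_mul] at this
    omega
  · have := Nat.mul_le_mul_right B (Nat.succ_le_of_lt hlt)
    rw [Nat.succ_mul] at this
    omega

theorem IsFolner.hasDensity_range_N₁ {F : ℕ+ → Finset ℕ+} (hF : IsFolner F) :
    HasDensity F (Set.range N₁) 0 := by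
  refine hasDensity_zero_of_eventually_le fun ε hε => ?_
  obtain ⟨M, hM⟩ := exists_nat_gt (4 / ε)
  obtain ⟨p, hMp, hp⟩ := Nat.exists_infinite_primes M
  have hp0 : (0 : ℝ) < p := by exact_mod_cast hp.pos
  have hpε : 1 / (p : ℝ) ≤ ε / 4 := by
    have : 4 / ε < p := hM.trans_le (by exact_mod_cast hMp)
    rw [div_lt_iff₀ hε] at this
    rw [div_le_iff₀ hp0]
    linarith
  have hsub : Set.range N₁ ⊆
      {x : ℕ+ | p ∣ x} ∪ {x : ℕ+ | (x : ℕ) ≤ (p ^ 4) ^ (p ^ 2)} := fun n hn =>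
    (le_or_gt (n : ℕ) ((p ^ 4) ^ (p ^ 2))).elim Or.inr
      fun hlt => Or.inl (dvd_of_mem_range_N₁ hp hn hlt)
  filter_upwards [hF.eventually_proportion_multiples_le hp.pos (show 0 < ε / 4 by positivity),
    hF.eventually_proportion_bounded_le ((p ^ 4) ^ (p ^ 2)) hp.pos
      (show 0 < ε / 4 by positivity)] with n h1 h2
  have h3 := (proportion_mono (F n) hsub).trans (proportion_union_le _ _ _)
  linarith

/-! ### Integers with few prime factors -/

/-- Since `∑ 1 / p` diverges, the proportion `∏ (1 - 1 / p)` of integers coprime to all primes of a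
finite set beyond `N` can be made arbitrarily small. -/
theorem exists_primes_totient_prod_le (N : ℕ) {ε : ℝ} (hε : 0 < ε) :
    ∃ P : Finset ℕ, (∀ p ∈ P, p.Prime ∧ N < p) ∧
      (Nat.totient (∏ p ∈ P, p) : ℝ) ≤ ε * (∏ p ∈ P, p : ℕ) := by
  have htend := (not_summable_iff_tendsto_nat_atTop_of_nonneg
    (fun n => Set.indicator_nonneg (fun n _ => by positivity) n)).1 not_summable_one_div_on_primes
  set f : ℕ → ℝ := Set.indicator {p : ℕ | p.Prime} fun n => 1 / (n : ℝ) with hf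
  obtain ⟨M, hM, hNM⟩ := ((htend.eventually_ge_atTop
    ((∑ i ∈ Finset.range (N + 1), f i) + -Real.log ε)).and (eventually_ge_atTop (N + 1))).exists
  have hsum : -Real.log ε ≤ ∑ i ∈ Finset.Ico (N + 1) M, f i := by
    rw [Finset.sum_Ico_eq_sub _ hNM]
    linarith
  refine ⟨(Finset.Ico (N + 1) M).filter Nat.Prime, ?_, ?_⟩
  · intro p hp
    simp only [Finset.mem_filter, Finset.mem_Ico] at hp
    exact ⟨hp.2, by omega⟩
  set P := (Finset.Ico (N + 1) M).filter Nat.Prime with hP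
  have hPp : ∀ p ∈ P, p.Prime := fun p hp => (Finset.mem_filter.1 hp).2
  have hsum' : ∑ i ∈ Finset.Ico (N + 1) M, f i = ∑ p ∈ P, 1 / (p : ℝ) := by
    rw [hP, Finset.sum_filter]
    exact Finset.sum_congr rfl fun i _ => by simp [hf, Set.indicator_apply]
  have htot : (Nat.totient (∏ p ∈ P, p) : ℝ) =
      (∏ p ∈ P, p : ℕ) * ∏ p ∈ P, (1 - (p : ℝ)⁻¹) := by
    have h := Nat.totient_eq_mul_prod_factors (∏ p ∈ P, p)
    rw [Nat.primeFactors_prod hPp] at h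
    have h' := congrArg (fun q : ℚ => (q : ℝ)) h
    push_cast at h' ⊢
    exact h'
  have hprod : ∏ p ∈ P, (1 - (p : ℝ)⁻¹) ≤ ε := by
    calc ∏ p ∈ P, (1 - (p : ℝ)⁻¹) ≤ ∏ p ∈ P, Real.exp (-(1 / (p : ℝ))) := by
          refine Finset.prod_le_prod (fun p hp => ?_) fun p hp => ?_
          · have : (1 : ℝ) ≤ p := by exact_mod_cast (hPp p hp).pos
            exact sub_nonneg.2 (inv_le_one_of_one_le₀ this)
          · have := Real.add_one_le_exp (-(1 / (p : ℝ)))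
            rw [one_div] at this ⊢
            linarith
      _ = Real.exp (-∑ p ∈ P, 1 / (p : ℝ)) := by
          rw [← Real.exp_sum, Finset.sum_neg_distrib]
      _ ≤ Real.exp (Real.log ε) := Real.exp_le_exp.2 (by linarith)
      _ = ε := Real.exp_log hε
  rw [htot, mul_comm]
  gcongr

theorem eventually_card_coprime_le {Q : ℕ} (hQ : 0 < Q) {ε : ℝ} (hε : 0 < ε)
    (h : (Nat.totient Q : ℝ) ≤ ε * Q) :
    ∀ᶠ n : ℕ in atTop,
      (((Finset.Icc 1 n).filter (fun x => Q.Coprime x)).card : ℝ) ≤ 2 * ε * n := by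
  filter_upwards [tendsto_natCast_atTop_atTop.eventually_ge_atTop ((Q : ℝ))] with n hn
  have hQ' : (0 : ℝ) < Q := by exact_mod_cast hQ
  have h1 := Nat.Ico_filter_coprime_le 1 n hQ.ne'
  have h2 : Finset.Ico 1 (1 + n) = Finset.Icc 1 n := by
    ext x
    simp only [Finset.mem_Ico, Finset.mem_Icc]
    omega
  rw [h2] at h1
  have h3 : ((n / Q : ℕ) : ℝ) ≤ n / Q := Nat.cast_div_le
  have h4 : (1 : ℝ) ≤ n / Q := by rwa [one_le_div hQ']
  calc (((Finset.Icc 1 n).filter (fun x => Q.Coprime x)).card : ℝ)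
      ≤ Nat.totient Q * ((n / Q : ℕ) + 1) := by exact_mod_cast h1
    _ ≤ (ε * Q) * (n / Q + n / Q) := by gcongr
    _ = 2 * ε * n := by field_simp; ring

/-- For all `k` and `N`, the integers with fewer than `k` prime factors exceeding `N` have density
zero. -/
theorem eventually_card_few_primeFactors_le (k : ℕ) (N : ℕ) {ε : ℝ} (hε : 0 < ε) :
    ∀ᶠ n : ℕ in atTop, (((Finset.Icc 1 n).filter
      (fun x => (x.primeFactors.filter (N < ·)).card < k)).card : ℝ) ≤ ε * n := by
  induction k generalizing N ε with
  | zero => exact .of_forall fun n => by simp; positivity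
  | succ k ih =>
    obtain ⟨P, hP, hPε⟩ := exists_primes_totient_prod_le N (show 0 < ε / 4 by positivity)
    have hQ : 0 < ∏ p ∈ P, p := Finset.prod_pos fun p hp => (hP p hp).1.pos
    filter_upwards [eventually_card_coprime_le hQ (by positivity) hPε,
      ih (P.sup id) (show 0 < ε / 2 by positivity)] with n h1 h2
    -- An integer not coprime to `∏ p ∈ P, p` has a prime factor in `P`, which is lost when the
    -- bound `N` is raised to `P.sup id`.
    have hsub : (Finset.Icc 1 n).filter
        (fun x => (x.primeFactors.filter (N < ·)).card < k + 1) ⊆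
        (Finset.Icc 1 n).filter (fun x => (∏ p ∈ P, p).Coprime x) ∪ (Finset.Icc 1 n).filter
          (fun x => (x.primeFactors.filter (P.sup id < ·)).card < k) := by
      intro x hx
      rw [Finset.mem_filter] at hx
      rw [Finset.mem_union, Finset.mem_filter, Finset.mem_filter]
      by_cases hcop : (∏ p ∈ P, p).Coprime x
      · exact Or.inl ⟨hx.1, hcop⟩
      refine Or.inr ⟨hx.1, ?_⟩
      rw [Nat.coprime_prod_left_iff] at hcop
      push Not at hcop
      obtain ⟨p, hpP, hpx⟩ := hcop
      have hpp := (hP p hpP).1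
      have hdvd : p ∣ x := by
        by_contra hnd
        exact hpx (hpp.coprime_iff_not_dvd.2 hnd)
      have hx0 : x ≠ 0 := by have := (Finset.mem_Icc.1 hx.1).1; omega
      refine lt_of_lt_of_le (Finset.card_lt_card ?_) (Nat.lt_succ_iff.1 hx.2)
      refine Finset.ssubset_iff_subset_ne.2 ⟨?_, ?_⟩
      · refine Finset.monotone_filter_right _ fun q _ hq => ?_
        exact ((hP p hpP).2.trans_le (Finset.le_sup (f := id) hpP)).trans hq
      · intro heq
        have hmem : p ∈ x.primeFactors.filter (N < ·) :=
          Finset.mem_filter.2 ⟨Nat.mem_primeFactors.2 ⟨hpp, hdvd, hx0⟩, (hP p hpP).2⟩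
        rw [← heq, Finset.mem_filter] at hmem
        exact absurd hmem.2 (not_lt.2 (Finset.le_sup (f := id) hpP))
    have h3 : (_ : ℝ) ≤ _ := Nat.cast_le.2
      ((Finset.card_le_card hsub).trans (Finset.card_union_le _ _))
    rw [Nat.cast_add] at h3
    linarith

/-! ### Sections of the totient -/

theorem two_pow_card_dvd_totient {x : ℕ} :
    2 ^ (x.primeFactors.filter (2 < ·)).card ∣ Nat.totient x := by
  set S := x.primeFactors.filter (2 < ·) with hS
  have h1 : ∏ p ∈ x.primeFactors, (p - 1) ∣ Nat.totient x := by
    rw [Nat.totient_eq_div_primeFactors_mul]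
    exact Dvd.intro_left _ rfl
  refine dvd_trans ?_ h1
  refine dvd_trans ?_ (Finset.prod_dvd_prod_of_subset S _ _ (Finset.filter_subset _ _))
  rw [← Finset.prod_const]
  refine Finset.prod_dvd_prod_of_dvd _ _ fun p hp => ?_
  rw [hS, Finset.mem_filter] at hp
  obtain ⟨r, hr⟩ := (Nat.prime_of_mem_primeFactors hp.1).odd_of_ne_two hp.2.ne'
  exact ⟨r, by omega⟩

theorem card_filter_range_section_le {f : totients → ℕ+}
    (hf : ∀ m : totients, eulerPhi (f m) = m) (k : ℕ) (n : ℕ+) [DecidablePred (· ∈ Set.range f)] :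
    ((Finset.Icc 1 n).filter (fun x => x ∈ Set.range f)).card ≤
      ((Finset.Icc 1 (n : ℕ)).filter
        (fun x => (x.primeFactors.filter (2 < ·)).card < k)).card + (n : ℕ) / 2 ^ k := by
  set A := (Finset.Icc 1 n).filter (fun x => x ∈ Set.range f)
  rw [← Finset.card_filter_add_card_filter_not
    (fun x : ℕ+ => ((x : ℕ).primeFactors.filter (2 < ·)).card < k)]
  refine Nat.add_le_add ?_ ?_
  · refine Finset.card_le_card_of_injOn (fun x => (x : ℕ)) ?_ PNat.coe_injective.injOn
    intro x hx
    simp only [A, Finset.coe_filter, Finset.mem_filter, Finset.mem_Icc, Set.mem_ofPred_eq] at hx ⊢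
    exact ⟨⟨x.pos, hx.1.1.2⟩, hx.2⟩
  · rw [← Nat.Ioc_filter_dvd_card_eq_div]
    refine Finset.card_le_card_of_injOn (fun x => (eulerPhi x : ℕ)) ?_ ?_
    · intro x hx
      simp only [A, Finset.coe_filter, Finset.mem_filter, Finset.mem_Icc, Finset.mem_Ioc,
        Set.mem_ofPred_eq, not_lt] at hx ⊢
      exact ⟨⟨(eulerPhi x).pos, (Nat.totient_le x).trans hx.1.1.2⟩,
        (pow_dvd_pow 2 hx.2).trans two_pow_card_dvd_totient⟩
    · intro x hx y hy hxy
      simp only [A, Finset.coe_filter, Finset.mem_filter, Set.mem_ofPred_eq] at hx hy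
      obtain ⟨m, rfl⟩ := hx.1.2
      obtain ⟨m', rfl⟩ := hy.1.2
      have h := PNat.coe_injective hxy
      rw [hf, hf] at h
      rw [Subtype.ext h]

theorem hasAsymptoticDensity_range_section {f : totients → ℕ+}
    (hf : ∀ m : totients, eulerPhi (f m) = m) : HasAsymptoticDensity (Set.range f) 0 := by
  classical
  refine hasDensity_zero_of_eventually_le fun ε hε => ?_
  obtain ⟨k, hk⟩ := exists_pow_lt_of_lt_one (half_pos hε) (show (1 / 2 : ℝ) < 1 by norm_num)
  filter_upwards [tendsto_PNat_val_atTop_atTop.eventually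
    (eventually_card_few_primeFactors_le k 2 (half_pos hε))] with n hn
  have hn0 : (0 : ℝ) < (n : ℕ) := by exact_mod_cast n.pos
  have hcard : (Finset.Icc 1 n).card = (n : ℕ) := by simp [PNat.card_Icc]
  have h1 : ((((Finset.Icc 1 n).filter (fun x => x ∈ Set.range f)).card : ℕ) : ℝ) ≤ _ :=
    Nat.cast_le.2 (card_filter_range_section_le hf k n)
  have h2 : (((n : ℕ) / 2 ^ k : ℕ) : ℝ) ≤ ε / 2 * (n : ℕ) := by
    refine Nat.cast_div_le.trans ?_
    rw [Nat.cast_pow, Nat.cast_two, div_eq_mul_inv, mul_comm, ← inv_pow, ← one_div]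
    gcongr
  unfold proportion
  rw [hcard, div_le_iff₀ hn0]
  rw [Nat.cast_add] at h1
  refine le_trans (le_of_eq ?_) ((h1.trans (add_le_add hn h2)).trans (le_of_eq ?_))
  · congr!
  · ring

theorem theorem1 :
    banachDensity (Set.range N₁) = 0 ∧
    (∀ f : totients → ℕ+, (∀ m : totients, f m ∈ eulerPhi ⁻¹' {(m : ℕ+)}) →
      HasAsymptoticDensity (Set.range f) 0) ∧
    HasAsymptoticDensity (Set.range N₂) 0 ∧
    HasAsymptoticDensity (Set.range N₃) 0 := by
  refine ⟨?_, fun f hf => hasAsymptoticDensity_range_section hf,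
    hasAsymptoticDensity_range_section fun m => (exists_isGreatest_fiber m).choose_spec.1,
    hasAsymptoticDensity_range_section fun m => (exists_isLeast_fiber m).choose_spec.1⟩
  -- The set of upper densities has no nonzero element, so its supremum is zero.
  have h : ∀ d ∈ {d : ℝ | ∃ F : ℕ+ → Finset ℕ+, IsFolner F ∧
      d = upperDensity F (Set.range N₁)}, d = 0 := by
    rintro d ⟨F, hF, rfl⟩
    exact hF.hasDensity_range_N₁.limsup_eq
  exact le_antisymm (Real.sSup_le (fun d hd => (h d hd).le) le_rfl)
    (Real.sSup_nonneg fun d hd => (h d hd).ge)
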